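/- **Setting.** Let $d\ge 3$, $N\ge 1$, $T\ge 0$ be integers. There are $T+1$ models, the target $t=0$ and the sources $t=1,\dots,T$; a sample from model $t$ has law $\mathcal N(\theta_t,\sigma_t^2 I_d)$ on $\mathbb R^d$, where the variances $\boldsymbol\Gamma=(\sigma_0^2,\dots,\sigma_T^2)\in[0,\infty)^{T+1}$ are known and $\boldsymbol\theta=(\theta_0,\dots,\theta_T)\in(\mathbb R^d)^{T+1}$ is unknown. A learner collects $N$ samples adaptively: with independent $Z_{i,t}\sim\mathcal N(\theta_t,\sigma_t^2I_d)$, in round $i$ it draws a model index $A_i\in\{0,\dots,T\}$ from a distribution $\pi_i$ that depends only on the history $(A_j,S_j)_{j<i}$, and observes $S_i=Z_{i,A_i}$; after $N$ rounds it outputs a (possibly randomized) estimate $\hat\theta$ based on $(A_i,S_i)_{i\le N}$. For $\boldsymbol\Psi\subseteq(\mathbb R^d)^{T+1}$ the minimax risk is $$L_{N,d}(\boldsymbol\Psi,\boldsymbol\Gamma)=\inf_{(\pi,\hat\theta)}\ \sup_{\boldsymbol\theta\in\boldsymbol\Psi}\ \mathbb E\,\|\hat\theta-\theta_0\|^2 .$$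 Let $\boldsymbol q=(q_0,\dots,q_T)\in\mathbb R^{T+1}$ with $q_0^2=0\le q_1^2\le\dots\le q_T^2$, and let $\sigma_0^2\ge\sigma_1^2\ge\dots\ge\sigma_T^2$. Put $$\boldsymbol\Psi_=(\boldsymbol q)=\bigcup_{\zeta\in\mathfrak S_T}\{\boldsymbol\theta:\ \|\theta_t-\theta_0\|^2=q_{\zeta(t)}^2\ \text{for all } 1\le t\le T\},\qquad \boldsymbol\Psi_*(r)=\{\boldsymbol\theta:\ \|\theta_t-\theta_0\|^2=r^2\ \text{for some } 1\le t\le T\}.$$ Let $\mathcal T_{\mathrm{wo}}=\{1\le t\le T:\ q_t^2\le d\sigma_0^2/N\}$ be the weak-oracle set with $\kappa=1$. Let $t_{\mathrm{wo}}=0$ if $\mathcal T_{\mathrm{wo}}=\emptyset$; otherwise let $t_{\mathrm{wo}}$ be an element of $\mathcal T_{\mathrm{wo}}$ of minimal $\sigma_t^2$ and, among those, of maximal $q_t^2$. Write $\sigma_{\mathrm{wo}}^2=\sigma_{t_{\mathrm{wo}}}^2$ and $q_{\mathrm{wo}}=q_{t_{\mathrm{wo}}}$. **Theorem.** For every $d\ge3$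 there is a constant $c(d)\ge e^{-5}$, depending only on $d$, such that for all $N$, $T$, $\boldsymbol\Gamma$, $\boldsymbol q$ as above: 1. If $d\sigma_{\mathrm{wo}}^2/N\ge q_{\mathrm{wo}}^2$, then $$L_{N,d}(\boldsymbol\Psi_=(\boldsymbol q),\boldsymbol\Gamma)\ \ge\ \frac{c(d)^2}{2}\cdot\frac{d\sigma_{\mathrm{wo}}^2}{N},$$ and, if moreover $\mathcal T_{\mathrm{wo}}\neq\emptyset$, then $L_{N,d}(\boldsymbol\Psi_*(q_{\mathrm{wo}}),\boldsymbol\Gamma)\ge L_{N,d}(\boldsymbol\Psi_=(\boldsymbol q),\boldsymbol\Gamma)$, so the same lower bound holds for $\boldsymbol\Psi_*(q_{\mathrm{wo}})$. 2. If $d\sigma_{\mathrm{wo}}^2/N<q_{\mathrm{wo}}^2$, then $$L_{N,d}(\boldsymbol\Psi_*(q_{\mathrm{wo}}),\boldsymbol\Gamma)\ \ge\ \frac{c(d)^2}{8}\cdot q_{\mathrm{wo}}^2 .$$ -/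

import Mathlib

open MeasureTheory ProbabilityTheory
open scoped ENNReal NNReal

noncomputable section

namespace CurriculumLearning

/-- The parameter and sample space `ℝ^d`, with its Euclidean norm. -/
abbrev Vec (d : ℕ) : Type := EuclideanSpace ℝ (Fin d)

/-- The models `{0, 1, …, T}`: `0` is the target, `1, …, T` are the sources. -/
abbrev ModelIdx (T : ℕ) : Type := Fin (T + 1)

/-- The history after `n` rounds: the chosen models and the samples collected. -/
abbrev History (d T n : ℕ) : Type := Fin n → ModelIdx T × Vec d

/-- The isotropic Gaussian law `N(θ, v • I_d)` on `ℝ^d` (a point mass if `v = 0`). -/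
def gaussianVec {d : ℕ} (θ : Vec d) (v : ℝ≥0) : Measure (Vec d) :=
  (Measure.pi fun k : Fin d => gaussianReal (θ k) v).map (WithLp.toLp 2)

/-- An adaptive algorithm: `policy i` is the conditional law of the model chosen in round `i`
(counted from `0`) given the history of the earlier rounds, and `estimator` is the, possibly
randomized, estimator of the target parameter given all `N` observations. -/
structure Algorithm (N d T : ℕ) where
  policy : (i : ℕ) → Kernel (History d T i) (ModelIdx T)
  policy_markov : ∀ i, IsMarkovKernel (policy i)
  estimator : Kernel (History d T N) (Vec d)
  estimator_markov : IsMarkovKernel estimator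

/-- One row `(Z_{i,t})_{0 ≤ t ≤ T}` of the random table: independent entries, `Z_{i,t}` of law
`N(θ t, σ2 t • I_d)`. -/
def tableRow {d T : ℕ} (σ2 : ModelIdx T → ℝ≥0) (θ : ModelIdx T → Vec d) :
    Measure (ModelIdx T → Vec d) :=
  Measure.pi fun t => gaussianVec (θ t) (σ2 t)

/-- Append the choice `a` and the sample `z a` (the entry of the table row `z` in the chosen
column) to a history. -/
def extendHistory {d T n : ℕ} (p : History d T n × (ModelIdx T × (ModelIdx T → Vec d))) :
    History d T (n + 1) :=
  Fin.snoc (α := fun _ => ModelIdx T × Vec d) p.1 (p.2.1, p.2.2 p.2.1)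

/-- The law of the history after `n` rounds: in each round a fresh row of the table, independent
of the past, and a choice drawn from the policy given the past, conditionally independent of that
row; the learner sees the entry of the row in the chosen column. -/
def historyLaw {N d T : ℕ} (A : Algorithm N d T) (σ2 : ModelIdx T → ℝ≥0)
    (θ : ModelIdx T → Vec d) : (n : ℕ) → Measure (History d T n)
  | 0 => Measure.dirac Fin.elim0
  | n + 1 =>
    ((historyLaw A σ2 θ n) ⊗ₘ (A.policy n ×ₖ Kernel.const _ (tableRow σ2 θ))).map extendHistory

/-- The risk `E ‖θ̂ - θ 0‖²` of an algorithm that collects `N` samples. -/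
def risk {N d T : ℕ} (A : Algorithm N d T) (σ2 : ModelIdx T → ℝ≥0)
    (θ : ModelIdx T → Vec d) : ℝ≥0∞ :=
  ∫⁻ h, ∫⁻ x, ENNReal.ofReal (‖x - θ 0‖ ^ 2) ∂(A.estimator h) ∂(historyLaw A σ2 θ N)

/-- The minimax risk over the parameters in `Ψ` for known noise variances `σ2`. -/
def minimaxRisk (N : ℕ) {d T : ℕ} (Ψ : Set (ModelIdx T → Vec d)) (σ2 : ModelIdx T → ℝ≥0) :
    ℝ≥0∞ :=
  ⨅ A : Algorithm N d T, ⨆ θ ∈ Ψ, risk A σ2 θ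

/-- The fully localized set `Ψ_=(q)`: up to a permutation of the sources, the distances of the
source parameters to the target parameter are `q 1, …, q T`. -/
def fullyLocalized (d : ℕ) {T : ℕ} (q : ModelIdx T → ℝ) : Set (ModelIdx T → Vec d) :=
  ⋃ ζ : Equiv.Perm (Fin T), {θ | ∀ t : Fin T, ‖θ t.succ - θ 0‖ ^ 2 = q (ζ t).succ ^ 2}

/-- The single localized-source set `Ψ_*(r)`: some source parameter is at distance `r` from the
target parameter. -/
def singleLocalized (d T : ℕ) (r : ℝ) : Set (ModelIdx T → Vec d) :=
  {θ | ∃ t : Fin T, ‖θ t.succ - θ 0‖ ^ 2 = r ^ 2}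

/-- The weak-oracle set (of source models) for the distances `q`. -/
def weakOracleSet (κ : ℝ) (N d : ℕ) {T : ℕ} (σ2 : ModelIdx T → ℝ≥0) (q : ModelIdx T → ℝ) :
    Set (ModelIdx T) :=
  {t | t ≠ 0 ∧ q t ^ 2 ≤ κ * (d * σ2 0 / N)}

/-- `t` is the model chosen by the weak oracle from the set `S` of sources: the target if `S` is
empty, otherwise a model of minimal noise variance in `S`, and among those one of maximal
distance. (All such `t` share the same variance and the same squared distance.) -/
def IsWeakOracleModel {T : ℕ} (σ2 : ModelIdx T → ℝ≥0) (q : ModelIdx T → ℝ)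
    (S : Set (ModelIdx T)) (t : ModelIdx T) : Prop :=
  (S = ∅ ∧ t = 0) ∨
    (t ∈ S ∧ (∀ s ∈ S, σ2 t ≤ σ2 s) ∧ ∀ s ∈ S, σ2 s = σ2 t → q s ^ 2 ≤ q t ^ 2)

end CurriculumLearning

end

/-!
Along an adaptive experiment the Hellinger affinity of the laws under two parameters `θ`, `θ'` is at
least the product over the rounds of the smallest affinity of the sampling laws, however the policy
chooses: given the past, a round is a mixture of the sampling laws with weights that do not depend
on the parameter. Two parameters with `‖θ t - θ' t‖²` at most of order `σ2 t / N` for all `t` thus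
keep an affinity bounded below, and Le Cam's two-point bound in each coordinate, averaged over the
vertices of a cube (Assouad), bounds the risk below by a multiple of the squared norm of a vertex.

For `fullyLocalized` the target and all models at least as noisy as the weak oracle are placed so
that they move with the vertex. A less noisy model is farther from the target than the radius of
the cube, so it can be put at a fixed point of the axis orthogonal to the cube, at equal distance
from all the vertices, where it carries no information. For `singleLocalized` only the target
moves, on a sphere of radius `|q|` about the common parameter of the sources.
-/

namespace CurriculumLearning

section Affinity

variable {α β : Type*} [MeasurableSpace α] [MeasurableSpace β]

theorem sq_lintegral_le_lintegral_mul_lintegral {μ : Measure α} {f g r : α → ℝ≥0∞}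
    (hf : Measurable f) (hg : Measurable g) (h : ∀ x, r x ^ 2 ≤ f x * g x) :
    (∫⁻ x, r x ∂μ) ^ 2 ≤ (∫⁻ x, f x ∂μ) * ∫⁻ x, g x ∂μ := by
  have hr : ∀ x, r x ≤ f x ^ (1 / 2 : ℝ) * g x ^ (1 / 2 : ℝ) := fun x => by
    rw [← ENNReal.mul_rpow_of_nonneg _ _ (by norm_num), one_div,
      ENNReal.le_rpow_inv_iff two_pos]
    exact_mod_cast h x
  have hint := (lintegral_mono hr).trans (ENNReal.lintegral_mul_norm_pow_le hf.aemeasurable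
    hg.aemeasurable one_half_pos.le one_half_pos.le (add_halves 1) (μ := μ))
  rw [← ENNReal.mul_rpow_of_nonneg _ _ (by norm_num), one_div,
    ENNReal.le_rpow_inv_iff two_pos] at hint
  exact_mod_cast hint

/-- The squared Hellinger affinity `(∫ √(dμ dν))²` of two measures, encoded by the equality case of
the Cauchy-Schwarz inequality: it is the infimum of `(∫ f dμ) (∫ g dν)` over `f g ≥ 1`. No common
dominating measure appears, so that it passes to products and to Markov kernels directly. -/
noncomputable def sqAffinity (μ ν : Measure α) : ℝ≥0∞ :=
  ⨅ (f : α → ℝ≥0∞) (g : α → ℝ≥0∞) (_ : Measurable f) (_ : Measurable g)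
    (_ : ∀ x, 1 ≤ f x * g x), (∫⁻ x, f x ∂μ) * ∫⁻ x, g x ∂ν

theorem le_sqAffinity_iff {μ ν : Measure α} {c : ℝ≥0∞} :
    c ≤ sqAffinity μ ν ↔ ∀ f g : α → ℝ≥0∞, Measurable f → Measurable g →
      (∀ x, 1 ≤ f x * g x) → c ≤ (∫⁻ x, f x ∂μ) * ∫⁻ x, g x ∂ν := by
  simp only [sqAffinity, le_iInf_iff]

theorem sqAffinity_mul_le {μ ν : Measure α} {e : ℝ≥0∞} {f g : α → ℝ≥0∞} (hf : Measurable f)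
    (hg : Measurable g) (hfg : ∀ x, e ≤ f x * g x) :
    sqAffinity μ ν * e ≤ (∫⁻ x, f x ∂μ) * ∫⁻ x, g x ∂ν := by
  refine ENNReal.mul_le_of_forall_lt fun c hc b hb => ?_
  rcases eq_or_ne b 0 with rfl | hb0
  · simp
  have hnormalized := le_sqAffinity_iff.1 hc.le f (fun x => b⁻¹ * g x) hf (hg.const_mul _)
    fun x => by
      rw [mul_left_comm, ← ENNReal.inv_mul_cancel hb0 hb.ne_top]
      gcongr
      exact hb.le.trans (hfg x)
  rwa [lintegral_const_mul _ hg, mul_left_comm, mul_comm b⁻¹, ← div_eq_mul_inv,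
    ENNReal.le_div_iff_mul_le (.inl hb0) (.inl hb.ne_top)] at hnormalized

theorem sq_lintegral_le_sqAffinity_withDensity {ρ : Measure α} {p q r : α → ℝ≥0∞}
    (hp : Measurable p) (hq : Measurable q) (h : ∀ x, r x ^ 2 ≤ p x * q x) :
    (∫⁻ x, r x ∂ρ) ^ 2 ≤ sqAffinity (ρ.withDensity p) (ρ.withDensity q) := by
  refine le_sqAffinity_iff.2 fun f g hf hg hfg => ?_
  rw [lintegral_withDensity_eq_lintegral_mul _ hp hf,
    lintegral_withDensity_eq_lintegral_mul _ hq hg]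
  refine sq_lintegral_le_lintegral_mul_lintegral (hp.mul hf) (hq.mul hg) fun x => ?_
  calc r x ^ 2 ≤ p x * q x * 1 := by simpa using h x
    _ ≤ p x * q x * (f x * g x) := by gcongr; exact hfg x
    _ = (p * f) x * (q * g) x := mul_mul_mul_comm ..

theorem one_le_sqAffinity_self (μ : Measure α) [IsProbabilityMeasure μ] : 1 ≤ sqAffinity μ μ := by
  simpa using sq_lintegral_le_sqAffinity_withDensity (ρ := μ) (p := 1) (q := 1) (r := 1)
    measurable_one measurable_one fun x => by simp

theorem sqAffinity_le_sqAffinity_map (μ ν : Measure α) {φ : α → β} (hφ : Measurable φ) :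
    sqAffinity μ ν ≤ sqAffinity (μ.map φ) (ν.map φ) := by
  refine le_sqAffinity_iff.2 fun f g hf hg hfg => ?_
  rw [lintegral_map hf hφ, lintegral_map hg hφ]
  exact le_sqAffinity_iff.1 le_rfl _ _ (hf.comp hφ) (hg.comp hφ) fun x => hfg _

theorem sqAffinity_mul_le_sqAffinity_compProd (μ ν : Measure α) [SFinite μ] [SFinite ν]
    {κ η : Kernel α β} [IsSFiniteKernel κ] [IsSFiniteKernel η] {e : ℝ≥0∞}
    (h : ∀ x, e ≤ sqAffinity (κ x) (η x)) :
    sqAffinity μ ν * e ≤ sqAffinity (μ ⊗ₘ κ) (ν ⊗ₘ η) := by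
  refine le_sqAffinity_iff.2 fun f g hf hg hfg => ?_
  rw [Measure.lintegral_compProd hf, Measure.lintegral_compProd hg]
  exact sqAffinity_mul_le hf.lintegral_kernel_prod_right' hg.lintegral_kernel_prod_right' fun x =>
    le_sqAffinity_iff.1 (h x) _ _ (hf.comp measurable_prodMk_left)
      (hg.comp measurable_prodMk_left) fun y => hfg _

theorem sqAffinity_mul_le_sqAffinity_prod (μ ν : Measure α) [SFinite μ] [SFinite ν]
    (μ' ν' : Measure β) [SFinite μ'] [SFinite ν'] :
    sqAffinity μ ν * sqAffinity μ' ν' ≤ sqAffinity (μ.prod μ') (ν.prod ν') := by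
  simpa only [Measure.compProd_const] using sqAffinity_mul_le_sqAffinity_compProd μ ν
    (κ := Kernel.const α μ') (η := Kernel.const α ν') fun _ => le_rfl

theorem prod_sqAffinity_le_sqAffinity_pi {n : ℕ} (μ ν : Fin n → Measure α)
    [∀ i, IsProbabilityMeasure (μ i)] [∀ i, IsProbabilityMeasure (ν i)] :
    ∏ i, sqAffinity (μ i) (ν i) ≤ sqAffinity (Measure.pi μ) (Measure.pi ν) := by
  induction n with
  | zero =>
    have hμν : Measure.pi μ = Measure.pi ν := congrArg _ (Subsingleton.elim μ ν)
    simpa [hμν] using one_le_sqAffinity_self (Measure.pi ν)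
  | succ n ih =>
    rw [← (measurePreserving_piFinSuccAbove μ 0).symm.map_eq,
      ← (measurePreserving_piFinSuccAbove ν 0).symm.map_eq, Fin.prod_univ_succ]
    calc _ ≤ sqAffinity (μ 0) (ν 0) * sqAffinity (Measure.pi fun i : Fin n => μ i.succ)
          (Measure.pi fun i : Fin n => ν i.succ) := by gcongr; exact ih _ _
      _ ≤ _ := sqAffinity_mul_le_sqAffinity_prod _ _ _ _
      _ ≤ _ := sqAffinity_le_sqAffinity_map _ _ (MeasurableEquiv.measurable _)

theorem sq_sub_mul_sqAffinity_le (μ ν : Measure α) [IsProbabilityMeasure μ]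
    [IsProbabilityMeasure ν] {X : α → ℝ} (hX : Measurable X) (a b : ℝ) :
    ENNReal.ofReal ((a - b) ^ 2) * sqAffinity μ ν ≤
      4 * (∫⁻ x, ENNReal.ofReal ((X x - a) ^ 2) ∂μ +
        ∫⁻ x, ENNReal.ofReal ((X x - b) ^ 2) ∂ν) := by
  set A := ∫⁻ x, ENNReal.ofReal ((X x - a) ^ 2) ∂μ
  set B := ∫⁻ x, ENNReal.ofReal ((X x - b) ^ 2) ∂ν
  rw [mul_comm 4, ← ENNReal.div_le_iff_le_mul (.inl four_ne_zero) (.inl ENNReal.ofNat_ne_top)]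
  refine le_of_forall_gt_imp_ge_of_dense fun t ht => ?_
  rcases eq_or_ne t ∞ with rfl | ht_top
  · exact le_top
  have ht0 : t ≠ 0 := ht.ne_bot
  -- The weights `(X - a)² + t` and `(X - b)² + t` depend on the estimate alone, and their product
  -- is at least `(a - b)² t` since `((X - a) (X - b) + t)² ≥ 0`.
  have hpoint : ∀ x, ENNReal.ofReal ((a - b) ^ 2) * t ≤
      (ENNReal.ofReal ((X x - a) ^ 2) + t) * (ENNReal.ofReal ((X x - b) ^ 2) + t) := fun x => by
    lift t to ℝ≥0 using ht_top
    rw [← ENNReal.ofReal_coe_nnreal (p := t), ← ENNReal.ofReal_add (by positivity) (by positivity),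
      ← ENNReal.ofReal_add (by positivity) (by positivity), ← ENNReal.ofReal_mul (by positivity),
      ← ENNReal.ofReal_mul (by positivity)]
    refine ENNReal.ofReal_le_ofReal ?_
    linear_combination sq_nonneg ((X x - a) * (X x - b) + t)
  have hintegral : sqAffinity μ ν * (ENNReal.ofReal ((a - b) ^ 2) * t) ≤ (A + t) * (B + t) := by
    refine (sqAffinity_mul_le (by fun_prop) (by fun_prop) hpoint).trans_eq ?_
    rw [lintegral_add_right _ measurable_const, lintegral_add_right _ measurable_const]
    simp [A, B]
  rw [ENNReal.div_le_iff_le_mul (.inl four_ne_zero) (.inl ENNReal.ofNat_ne_top),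
    ← ENNReal.mul_le_mul_iff_left ht0 ht_top]
  calc ENNReal.ofReal ((a - b) ^ 2) * sqAffinity μ ν * t
      = sqAffinity μ ν * (ENNReal.ofReal ((a - b) ^ 2) * t) := by ring
    _ ≤ (A + t) * (B + t) := hintegral
    _ ≤ (t + t) * (t + t) := by
      gcongr
      exacts [le_self_add.trans ht.le, le_add_self.trans ht.le]
    _ = t * 4 * t := by ring

end Affinity

section Gaussian

theorem gaussianPDFReal_mul_gaussianPDFReal (m₁ m₂ : ℝ) (v : ℝ≥0) (x : ℝ) :
    gaussianPDFReal m₁ v x * gaussianPDFReal m₂ v x =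
      (Real.exp (-((m₁ - m₂) ^ 2 / (8 * v))) * gaussianPDFReal ((m₁ + m₂) / 2) v x) ^ 2 := by
  simp only [gaussianPDFReal]
  rw [mul_mul_mul_comm, ← Real.exp_add, mul_left_comm, ← Real.exp_add, mul_pow, ← sq,
    ← Real.exp_nat_mul]
  congr 2
  push_cast
  ring

theorem exp_le_sqAffinity_gaussianReal (m₁ m₂ : ℝ) {v : ℝ≥0} (hv : v ≠ 0) :
    ENNReal.ofReal (Real.exp (-((m₁ - m₂) ^ 2 / (4 * v)))) ≤
      sqAffinity (gaussianReal m₁ v) (gaussianReal m₂ v) := by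
  rw [gaussianReal_of_var_ne_zero _ hv, gaussianReal_of_var_ne_zero _ hv]
  refine le_trans (le_of_eq ?_) (sq_lintegral_le_sqAffinity_withDensity
    (r := fun x => ENNReal.ofReal (Real.exp (-((m₁ - m₂) ^ 2 / (8 * v)))) *
      gaussianPDF ((m₁ + m₂) / 2) v x)
    (measurable_gaussianPDF _ _) (measurable_gaussianPDF _ _) fun x => le_of_eq ?_)
  · rw [lintegral_const_mul _ (measurable_gaussianPDF _ _), lintegral_gaussianPDF_eq_one _ hv,
      mul_one, ← ENNReal.ofReal_pow (by positivity), ← Real.exp_nat_mul]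
    congr 2
    push_cast
    ring
  · simp only [gaussianPDF]
    rw [← ENNReal.ofReal_mul (Real.exp_pos _).le, ← ENNReal.ofReal_mul (gaussianPDFReal_nonneg ..),
      gaussianPDFReal_mul_gaussianPDFReal, ENNReal.ofReal_pow
        (mul_nonneg (Real.exp_pos _).le (gaussianPDFReal_nonneg ..))]

instance {d : ℕ} (θ : Vec d) (v : ℝ≥0) : IsProbabilityMeasure (gaussianVec θ v) :=
  Measure.isProbabilityMeasure_map (by fun_prop)

theorem exp_norm_le_sqAffinity_gaussianVec {d : ℕ} (θ θ' : Vec d) {v : ℝ≥0} (hv : v ≠ 0) :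
    ENNReal.ofReal (Real.exp (-(‖θ - θ'‖ ^ 2 / (4 * v)))) ≤
      sqAffinity (gaussianVec θ v) (gaussianVec θ' v) := by
  calc _ = ∏ k, ENNReal.ofReal (Real.exp (-((θ k - θ' k) ^ 2 / (4 * v)))) := by
        rw [← ENNReal.ofReal_prod_of_nonneg fun _ _ => (Real.exp_pos _).le, ← Real.exp_sum,
          Finset.sum_neg_distrib, ← Finset.sum_div, EuclideanSpace.real_norm_sq_eq]
        simp only [PiLp.sub_apply]
    _ ≤ ∏ k, sqAffinity (gaussianReal (θ k) v) (gaussianReal (θ' k) v) := by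
        gcongr
        exact exp_le_sqAffinity_gaussianReal _ _ hv
    _ ≤ _ := prod_sqAffinity_le_sqAffinity_pi _ _
    _ ≤ _ := sqAffinity_le_sqAffinity_map _ _ (by fun_prop)

theorem exp_neg_le_sqAffinity_gaussianVec {d : ℕ} {θ θ' : Vec d} {v : ℝ≥0} {r : ℝ} (hr : 0 ≤ r)
    (h : ‖θ - θ'‖ ^ 2 ≤ 4 * v * r) :
    ENNReal.ofReal (Real.exp (-r)) ≤ sqAffinity (gaussianVec θ v) (gaussianVec θ' v) := by
  rcases eq_or_ne v 0 with rfl | hv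
  · obtain rfl : θ = θ' := by simpa [sub_eq_zero] using h
    exact le_trans (by simpa using hr) (one_le_sqAffinity_self _)
  · refine le_trans ?_ (exp_norm_le_sqAffinity_gaussianVec θ θ' hv)
    gcongr
    rwa [div_le_iff₀' (by positivity)]

end Gaussian

section Experiment

theorem measurable_finSnoc {α : Type*} [MeasurableSpace α] {n : ℕ} :
    Measurable fun p : (Fin n → α) × α => (Fin.snoc p.1 p.2 : Fin (n + 1) → α) := by
  refine measurable_pi_iff.2 fun i => Fin.lastCases ?_ (fun j => ?_) i
  · simpa only [Fin.snoc_last] using measurable_snd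
  · simp only [Fin.snoc_castSucc]
    fun_prop

theorem measurable_eval_choice {ι α : Type*} [Countable ι] [MeasurableSpace ι]
    [MeasurableSingletonClass ι] [MeasurableSpace α] :
    Measurable fun p : ι × (ι → α) => (p.1, p.2 p.1) :=
  measurable_fst.prodMk (measurable_from_prod_countable_right fun i => measurable_pi_apply i)

theorem map_prod_pi_eval_eq_compProd {ι α : Type*} [Fintype ι] [MeasurableSpace ι]
    [MeasurableSingletonClass ι] [MeasurableSpace α] (π : Measure ι) [SFinite π]
    (κ : Kernel ι α) [IsMarkovKernel κ] :
    (π.prod (Measure.pi κ)).map (fun p => (p.1, p.2 p.1)) = π ⊗ₘ κ := by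
  refine Measure.ext_of_lintegral _ fun f hf => ?_
  have hf' : Measurable fun p : ι × (ι → α) => f (p.1, p.2 p.1) := hf.comp measurable_eval_choice
  rw [lintegral_map hf measurable_eval_choice, lintegral_prod _ hf'.aemeasurable,
    Measure.lintegral_compProd hf]
  exact lintegral_congr fun i => (measurePreserving_eval (fun j => κ j) i).lintegral_comp
    (hf.comp measurable_prodMk_left)

variable {N d T : ℕ} (A : Algorithm N d T) (σ2 : ModelIdx T → ℝ≥0) (θ : ModelIdx T → Vec d)

instance : IsProbabilityMeasure (tableRow σ2 θ) :=
  inferInstanceAs (IsProbabilityMeasure (Measure.pi _))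

/-- The law of a sample as a kernel in the chosen model. -/
noncomputable def sampleKernel : Kernel (ModelIdx T) (Vec d) :=
  Kernel.ofFunOfCountable fun t => gaussianVec (θ t) (σ2 t)

instance : IsMarkovKernel (sampleKernel σ2 θ) :=
  ⟨fun t => inferInstanceAs (IsProbabilityMeasure (gaussianVec (θ t) (σ2 t)))⟩

/-- The law of the model chosen in round `n` together with the sample seen in that round, given the
history of the earlier rounds. -/
noncomputable def observationKernel (n : ℕ) : Kernel (History d T n) (ModelIdx T × Vec d) :=
  (A.policy n ×ₖ Kernel.const _ (tableRow σ2 θ)).map fun p => (p.1, p.2 p.1)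

instance (n : ℕ) : IsMarkovKernel (observationKernel A σ2 θ n) :=
  have := A.policy_markov n
  Kernel.IsMarkovKernel.map _ measurable_eval_choice

theorem observationKernel_apply (n : ℕ) (h : History d T n) :
    observationKernel A σ2 θ n h = A.policy n h ⊗ₘ sampleKernel σ2 θ := by
  have := A.policy_markov n
  rw [observationKernel, Kernel.map_apply _ measurable_eval_choice, Kernel.prod_apply,
    Kernel.const_apply]
  exact map_prod_pi_eval_eq_compProd _ (sampleKernel σ2 θ)

theorem historyLaw_succ (n : ℕ) [SFinite (historyLaw A σ2 θ n)] :
    historyLaw A σ2 θ (n + 1) =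
      (historyLaw A σ2 θ n ⊗ₘ observationKernel A σ2 θ n).map fun p => Fin.snoc p.1 p.2 := by
  have := A.policy_markov n
  rw [observationKernel, Measure.compProd_map measurable_eval_choice,
    Measure.map_map measurable_finSnoc (measurable_id.prodMap measurable_eval_choice)]
  rfl

instance (n : ℕ) : IsProbabilityMeasure (historyLaw A σ2 θ n) := by
  induction n with
  | zero => exact inferInstanceAs (IsProbabilityMeasure (Measure.dirac _))
  | succ n ih =>
    rw [historyLaw_succ]
    exact Measure.isProbabilityMeasure_map measurable_finSnoc.aemeasurable

/-- The joint law of the collected history and the estimate. -/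
noncomputable def outputLaw : Measure (History d T N × Vec d) :=
  historyLaw A σ2 θ N ⊗ₘ A.estimator

instance : IsProbabilityMeasure (outputLaw A σ2 θ) :=
  have := A.estimator_markov
  inferInstanceAs (IsProbabilityMeasure (historyLaw A σ2 θ N ⊗ₘ A.estimator))

variable {σ2 θ} {θ' : ModelIdx T → Vec d} {c : ℝ≥0∞}

theorem le_sqAffinity_observationKernel
    (h : ∀ t, c ≤ sqAffinity (gaussianVec (θ t) (σ2 t)) (gaussianVec (θ' t) (σ2 t))) (n : ℕ)
    (x : History d T n) :
    c ≤ sqAffinity (observationKernel A σ2 θ n x) (observationKernel A σ2 θ' n x) := by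
  have := A.policy_markov n
  rw [observationKernel_apply, observationKernel_apply]
  calc c ≤ sqAffinity (A.policy n x) (A.policy n x) * c :=
        le_mul_of_one_le_left' (one_le_sqAffinity_self _)
    _ ≤ _ := sqAffinity_mul_le_sqAffinity_compProd _ _ (κ := sampleKernel σ2 θ)
        (η := sampleKernel σ2 θ') h

theorem pow_le_sqAffinity_historyLaw
    (h : ∀ t, c ≤ sqAffinity (gaussianVec (θ t) (σ2 t)) (gaussianVec (θ' t) (σ2 t))) (n : ℕ) :
    c ^ n ≤ sqAffinity (historyLaw A σ2 θ n) (historyLaw A σ2 θ' n) := by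
  induction n with
  | zero => simpa [historyLaw] using one_le_sqAffinity_self (historyLaw A σ2 θ 0)
  | succ n ih =>
    rw [historyLaw_succ, historyLaw_succ]
    calc c ^ (n + 1) = c ^ n * c := pow_succ c n
      _ ≤ sqAffinity (historyLaw A σ2 θ n) (historyLaw A σ2 θ' n) * c := by gcongr
      _ ≤ _ := sqAffinity_mul_le_sqAffinity_compProd _ _ (le_sqAffinity_observationKernel A h n)
      _ ≤ _ := sqAffinity_le_sqAffinity_map _ _ measurable_finSnoc

theorem pow_le_sqAffinity_outputLaw
    (h : ∀ t, c ≤ sqAffinity (gaussianVec (θ t) (σ2 t)) (gaussianVec (θ' t) (σ2 t))) :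
    c ^ N ≤ sqAffinity (outputLaw A σ2 θ) (outputLaw A σ2 θ') := by
  have := A.estimator_markov
  calc c ^ N ≤ sqAffinity (historyLaw A σ2 θ N) (historyLaw A σ2 θ' N) * 1 := by
        simpa using pow_le_sqAffinity_historyLaw A h N
    _ ≤ _ := sqAffinity_mul_le_sqAffinity_compProd _ _ fun x => one_le_sqAffinity_self _

theorem exp_neg_le_sqAffinity_outputLaw {r : ℝ} (hr : 0 ≤ r)
    (h : ∀ t, ‖θ t - θ' t‖ ^ 2 ≤ 4 * σ2 t * r) :
    ENNReal.ofReal (Real.exp (-(N * r))) ≤ sqAffinity (outputLaw A σ2 θ) (outputLaw A σ2 θ') := by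
  rw [← mul_neg, Real.exp_nat_mul, ENNReal.ofReal_pow (Real.exp_pos _).le]
  exact pow_le_sqAffinity_outputLaw A fun t => exp_neg_le_sqAffinity_gaussianVec hr (h t)

variable (σ2 θ)

/-- The mean squared error of the estimate in the coordinate `k`. -/
noncomputable def coordRisk (k : Fin d) : ℝ≥0∞ :=
  ∫⁻ p, ENNReal.ofReal ((p.2 k - θ 0 k) ^ 2) ∂outputLaw A σ2 θ

theorem risk_eq_sum_coordRisk : risk A σ2 θ = ∑ k, coordRisk A σ2 θ k := by
  have := A.estimator_markov
  calc risk A σ2 θ = ∫⁻ p, ENNReal.ofReal (‖p.2 - θ 0‖ ^ 2) ∂outputLaw A σ2 θ :=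
        (Measure.lintegral_compProd (f := fun p => ENNReal.ofReal (‖p.2 - θ 0‖ ^ 2))
          (by fun_prop)).symm
    _ = ∫⁻ p, ∑ k, ENNReal.ofReal ((p.2 k - θ 0 k) ^ 2) ∂outputLaw A σ2 θ := by
        simp only [EuclideanSpace.real_norm_sq_eq, PiLp.sub_apply,
          ENNReal.ofReal_sum_of_nonneg fun _ _ => sq_nonneg _]
    _ = ∑ k, coordRisk A σ2 θ k := lintegral_finsetSum _ fun k _ => by fun_prop

variable {σ2 θ}

theorem le_coordRisk_add_coordRisk {r : ℝ} (hr : 0 ≤ r)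
    (h : ∀ t, ‖θ t - θ' t‖ ^ 2 ≤ 4 * σ2 t * r) (k : Fin d) :
    ENNReal.ofReal (Real.exp (-(N * r)) / 4 * (θ 0 k - θ' 0 k) ^ 2) ≤
      coordRisk A σ2 θ k + coordRisk A σ2 θ' k := by
  rw [← ENNReal.mul_le_mul_iff_right four_ne_zero ENNReal.ofNat_ne_top]
  calc 4 * ENNReal.ofReal (Real.exp (-(N * r)) / 4 * (θ 0 k - θ' 0 k) ^ 2)
      = ENNReal.ofReal ((θ 0 k - θ' 0 k) ^ 2) * ENNReal.ofReal (Real.exp (-(N * r))) := by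
        rw [← ENNReal.ofReal_ofNat 4, ← ENNReal.ofReal_mul (by positivity),
          ← ENNReal.ofReal_mul (by positivity)]
        congr 1
        ring
    _ ≤ ENNReal.ofReal ((θ 0 k - θ' 0 k) ^ 2) *
          sqAffinity (outputLaw A σ2 θ) (outputLaw A σ2 θ') := by
        gcongr
        exact exp_neg_le_sqAffinity_outputLaw A hr h
    _ ≤ 4 * (coordRisk A σ2 θ k + coordRisk A σ2 θ' k) :=
        sq_sub_mul_sqAffinity_le _ _ (by fun_prop) _ _

end Experiment

section Assouad

theorem card_mul_le_two_mul_of_le_add_flip {ι : Type*} [Finite ι] [DecidableEq ι]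
    {K : Finset ι} {R : (ι → ℤˣ) → ι → ℝ≥0∞} {b S : ℝ≥0∞}
    (hpair : ∀ v, ∀ k ∈ K, b ≤ R v k + R (Pi.mulSingle k (-1) * v) k)
    (hsum : ∀ v, ∑ k ∈ K, R v k ≤ S) : K.card * b ≤ 2 * S := by
  have := Fintype.ofFinite ι
  have hflip : ∑ v : ι → ℤˣ, ∑ k ∈ K, R (Pi.mulSingle k (-1) * v) k =
      ∑ v, ∑ k ∈ K, R v k := by
    rw [Finset.sum_comm, Finset.sum_comm (s := (Finset.univ : Finset (ι → ℤˣ))) (t := K)]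
    exact Finset.sum_congr rfl fun k _ =>
      Equiv.sum_comp (Equiv.mulLeft (Pi.mulSingle k (-1))) fun v => R v k
  rw [← ENNReal.mul_le_mul_iff_right (a := (Fintype.card (ι → ℤˣ) : ℝ≥0∞))
    (by exact_mod_cast Fintype.card_ne_zero) (ENNReal.natCast_ne_top _)]
  calc (Fintype.card (ι → ℤˣ) : ℝ≥0∞) * (K.card * b) = ∑ _v : ι → ℤˣ, ∑ _k ∈ K, b := by
        simp only [Finset.sum_const, nsmul_eq_mul, Finset.card_univ]
    _ ≤ ∑ v, ∑ k ∈ K, (R v k + R (Pi.mulSingle k (-1) * v) k) :=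
        Finset.sum_le_sum fun v _ => Finset.sum_le_sum fun k hk => hpair v k hk
    _ = 2 * ∑ v, ∑ k ∈ K, R v k := by simp only [Finset.sum_add_distrib, hflip, two_mul]
    _ ≤ 2 * ∑ _v : ι → ℤˣ, S := by
        gcongr with v
        exact hsum v
    _ = Fintype.card (ι → ℤˣ) * (2 * S) := by
        rw [Finset.sum_const, nsmul_eq_mul, Finset.card_univ, mul_left_comm]

/-- The vertex with signs `v` of the cube `[-a, a]^K` in `ℝ^d`; its coordinates outside `K`
vanish. -/
noncomputable def cubeVertex {d : ℕ} (K : Finset (Fin d)) (a : ℝ) (v : Fin d → ℤˣ) : Vec d :=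
  WithLp.toLp 2 fun j => if j ∈ K then ((v j : ℤ) : ℝ) * a else 0

variable {d : ℕ} {K : Finset (Fin d)}

theorem sq_intCast_unit_mul (u : ℤˣ) (a : ℝ) : (((u : ℤ) : ℝ) * a) ^ 2 = a ^ 2 := by
  rcases Int.units_eq_one_or u with rfl | rfl <;> simp

theorem norm_cubeVertex_sq (K : Finset (Fin d)) (a : ℝ) (v : Fin d → ℤˣ) :
    ‖cubeVertex K a v‖ ^ 2 = K.card * a ^ 2 := by
  simp [EuclideanSpace.real_norm_sq_eq, cubeVertex, ite_pow, sq_intCast_unit_mul]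

theorem cubeVertex_sub_flip {k : Fin d} (hk : k ∈ K) (a : ℝ) (v : Fin d → ℤˣ) :
    cubeVertex K a v - cubeVertex K a (Pi.mulSingle k (-1) * v) =
      EuclideanSpace.single k (((v k : ℤ) : ℝ) * (2 * a)) := by
  ext j
  rcases eq_or_ne j k with rfl | hj
  · have hneg : ((v j : ℤ) : ℝ) * a + ((v j : ℤ) : ℝ) * a = ((v j : ℤ) : ℝ) * (2 * a) := by ring
    simpa [cubeVertex, hk] using hneg
  · simp [cubeVertex, hj]

theorem norm_single_sub_cubeVertex_sq {k : Fin d} (hk : k ∉ K) (a b : ℝ) (v : Fin d → ℤˣ) :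
    ‖EuclideanSpace.single k b - cubeVertex K a v‖ ^ 2 = b ^ 2 + K.card * a ^ 2 := by
  have horth : inner ℝ (EuclideanSpace.single k b) (cubeVertex K a v) = 0 := by
    simp [EuclideanSpace.inner_single_left, cubeVertex, hk]
  rw [norm_sub_sq_real, horth, norm_cubeVertex_sq]
  simp

theorem le_minimaxRisk_of_cube {N T : ℕ} {σ2 : ModelIdx T → ℝ≥0} {Ψ : Set (ModelIdx T → Vec d)}
    {a r : ℝ} (hr : 0 ≤ r) {M : Set (ModelIdx T)} (h0 : 0 ∈ M) (hM : ∀ t ∈ M, a ^ 2 ≤ σ2 t * r)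
    (p : ModelIdx T → Vec d) (hΨ : ∀ v, p + M.indicator (fun _ => cubeVertex K a v) ∈ Ψ) :
    ENNReal.ofReal (Real.exp (-(N * r)) / 2 * (K.card * a ^ 2)) ≤ minimaxRisk N Ψ σ2 := by
  refine le_iInf fun A => ?_
  let θ : (Fin d → ℤˣ) → ModelIdx T → Vec d := fun v => p + M.indicator fun _ => cubeVertex K a v
  have hdiff : ∀ v, ∀ k ∈ K, ∀ t, θ v t - θ (Pi.mulSingle k (-1) * v) t =
      M.indicator (fun _ => EuclideanSpace.single k (((v k : ℤ) : ℝ) * (2 * a))) t := by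
    intro v k hk t
    by_cases ht : t ∈ M <;> simp [θ, ht, cubeVertex_sub_flip hk]
  have hclose : ∀ v, ∀ k ∈ K, ∀ t,
      ‖θ v t - θ (Pi.mulSingle k (-1) * v) t‖ ^ 2 ≤ 4 * σ2 t * r := by
    intro v k hk t
    rw [hdiff v k hk]
    by_cases ht : t ∈ M
    · rw [Set.indicator_of_mem ht, PiLp.norm_single, Real.norm_eq_abs, sq_abs,
        sq_intCast_unit_mul]
      linarith [hM t ht]
    · rw [Set.indicator_of_notMem ht, norm_zero, zero_pow two_ne_zero]
      positivity
  have hsep : ∀ v, ∀ k ∈ K,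
      (θ v 0 k - θ (Pi.mulSingle k (-1) * v) 0 k) ^ 2 = (2 * a) ^ 2 := by
    intro v k hk
    rw [← PiLp.sub_apply, hdiff v k hk, Set.indicator_of_mem h0, PiLp.single_apply,
      if_pos rfl, sq_intCast_unit_mul]
  have haverage := card_mul_le_two_mul_of_le_add_flip (R := fun v k => coordRisk A σ2 (θ v) k)
    (b := ENNReal.ofReal (Real.exp (-(N * r)) / 4 * (2 * a) ^ 2)) (S := ⨆ θ ∈ Ψ, risk A σ2 θ)
    (fun v k hk => hsep v k hk ▸ le_coordRisk_add_coordRisk A hr (hclose v k hk) k)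
    fun v => calc
      ∑ k ∈ K, coordRisk A σ2 (θ v) k ≤ ∑ k, coordRisk A σ2 (θ v) k :=
        Finset.sum_le_univ_sum_of_nonneg fun _ => zero_le
      _ = risk A σ2 (θ v) := (risk_eq_sum_coordRisk A σ2 (θ v)).symm
      _ ≤ _ := le_iSup₂ (f := fun θ (_ : θ ∈ Ψ) => risk A σ2 θ) (θ v) (hΨ v)
  rw [← ENNReal.mul_le_mul_iff_right two_ne_zero ENNReal.ofNat_ne_top]
  refine le_trans (le_of_eq ?_) haverage
  rw [← ENNReal.ofReal_ofNat 2, ← ENNReal.ofReal_mul zero_le_two, ← ENNReal.ofReal_natCast,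
    ← ENNReal.ofReal_mul (Nat.cast_nonneg _)]
  congr 1
  ring

end Assouad

section Localized

variable {N d T : ℕ} {σ2 : ModelIdx T → ℝ≥0} {q : ModelIdx T → ℝ}

theorem minimaxRisk_mono {Ψ Ψ' : Set (ModelIdx T → Vec d)} (h : Ψ ⊆ Ψ') :
    minimaxRisk N Ψ σ2 ≤ minimaxRisk N Ψ' σ2 :=
  iInf_mono fun _ => biSup_mono h

theorem fullyLocalized_subset_singleLocalized {t : ModelIdx T} (ht : t ≠ 0) :
    fullyLocalized d q ⊆ singleLocalized d T (q t) := by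
  intro θ hθ
  obtain ⟨ζ, hζ⟩ := Set.mem_iUnion.1 hθ
  obtain ⟨s, rfl⟩ := Fin.exists_succ_eq.2 ht
  exact ⟨ζ.symm s, by simpa using hζ (ζ.symm s)⟩

theorem mem_fullyLocalized {θ : ModelIdx T → Vec d}
    (h : ∀ t : Fin T, ‖θ t.succ - θ 0‖ ^ 2 = q t.succ ^ 2) : θ ∈ fullyLocalized d q :=
  Set.mem_iUnion.2 ⟨1, h⟩

theorem le_minimaxRisk_fullyLocalized {n : ℕ} (hq : q 0 = 0) {s : ℝ≥0} (h0 : s ≤ σ2 0)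
    (hfar : ∀ t, σ2 t < s → n * s / N ≤ q t ^ 2) :
    ENNReal.ofReal (Real.exp (-1) / 2 * (n * s / N)) ≤
      minimaxRisk N (fullyLocalized (n + 1) q) σ2 := by
  set a := √(s / N : ℝ)
  have ha : a ^ 2 = s / N := Real.sq_sqrt (by positivity)
  let K : Finset (Fin (n + 1)) := Finset.univ.erase (Fin.last n)
  have hcard : K.card = n := by simp [K]
  -- The models with variance at least `s` move along with the vertex. The others stay at a fixed
  -- point of the axis left out of `K`, which has the same distance `|q t|` from all vertices.
  let p : ModelIdx T → Vec (n + 1) := fun t =>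
    EuclideanSpace.single (Fin.last n) (if s ≤ σ2 t then q t else √(q t ^ 2 - n * a ^ 2))
  have hp0 : p 0 = 0 := by simp [p, h0, hq]
  calc ENNReal.ofReal (Real.exp (-1) / 2 * (n * s / N))
      ≤ ENNReal.ofReal (Real.exp (-(N * (N : ℝ)⁻¹)) / 2 * (K.card * a ^ 2)) := by
        rw [hcard, ha, mul_div_assoc]
        gcongr
        exact mul_inv_le_one
    _ ≤ _ := le_minimaxRisk_of_cube (M := {t | s ≤ σ2 t}) (by positivity) h0 (fun t ht => ?_) p
        fun v => mem_fullyLocalized fun t => ?_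
  · rw [ha, div_eq_mul_inv]
    gcongr
    exact ht
  · simp only [Pi.add_apply, hp0, zero_add,
      Set.indicator_of_mem (show 0 ∈ {t | s ≤ σ2 t} from h0)]
    by_cases ht : s ≤ σ2 t.succ
    · simp [p, ht]
    · have hle : n * a ^ 2 ≤ q t.succ ^ 2 := by
        simpa only [ha, mul_div_assoc] using hfar _ (not_le.1 ht)
      rw [Set.indicator_of_notMem (s := {t | s ≤ σ2 t}) ht, add_zero]
      simp only [p, if_neg ht]
      rw [norm_single_sub_cubeVertex_sq (by simp [K]), hcard,
        Real.sq_sqrt (sub_nonneg.2 hle), sub_add_cancel]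

theorem le_minimaxRisk_singleLocalized (hd : d ≠ 0) (hT : 0 < T) {r : ℝ}
    (h : r ^ 2 ≤ d * σ2 0 / N) :
    ENNReal.ofReal (Real.exp (-1) / 2 * r ^ 2) ≤ minimaxRisk N (singleLocalized d T r) σ2 := by
  set a := √(r ^ 2 / d)
  have ha : a ^ 2 = r ^ 2 / d := Real.sq_sqrt (by positivity)
  have hda : d * a ^ 2 = r ^ 2 := by
    rw [ha]
    field_simp
  calc ENNReal.ofReal (Real.exp (-1) / 2 * r ^ 2)
      ≤ ENNReal.ofReal (Real.exp (-(N * (N : ℝ)⁻¹)) / 2 *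
          ((Finset.univ : Finset (Fin d)).card * a ^ 2)) := by
        rw [Finset.card_fin, hda]
        gcongr
        exact mul_inv_le_one
    _ ≤ _ := le_minimaxRisk_of_cube (M := {0}) (Ψ := singleLocalized d T r) (r := (N : ℝ)⁻¹)
        (by positivity) rfl (fun t ht => ?_) 0 fun v => ⟨⟨0, hT⟩, ?_⟩
  · rw [Set.mem_singleton_iff.1 ht, ha, div_le_iff₀' (by positivity), ← mul_assoc,
      ← div_eq_mul_inv]
    exact h
  · simp [norm_cubeVertex_sq, hda]

theorem IsWeakOracleModel.eq_zero_or_mem {S : Set (ModelIdx T)} {t : ModelIdx T}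
    (h : IsWeakOracleModel σ2 q S t) : t = 0 ∨ t ∈ S :=
  h.imp And.right And.left

theorem IsWeakOracleModel.mem {S : Set (ModelIdx T)} {t : ModelIdx T}
    (h : IsWeakOracleModel σ2 q S t) (hS : S.Nonempty) : t ∈ S :=
  h.elim (fun h => absurd h.1 hS.ne_empty) And.left

theorem IsWeakOracleModel.notMem_of_lt {S : Set (ModelIdx T)} {s t : ModelIdx T}
    (h : IsWeakOracleModel σ2 q S t) (hst : σ2 s < σ2 t) : s ∉ S := by
  rcases h with ⟨rfl, -⟩ | ⟨-, hmin, -⟩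
  · exact Set.notMem_empty s
  · exact fun hs => (hmin s hs).not_gt hst

theorem IsWeakOracleModel.lt_sq_of_lt {κ : ℝ} {s t : ModelIdx T}
    (h : IsWeakOracleModel σ2 q (weakOracleSet κ N d σ2 q) t) (hst : σ2 s < σ2 t)
    (ht : σ2 t ≤ σ2 0) : κ * (d * σ2 0 / N) < q s ^ 2 := by
  have hs0 : s ≠ 0 := fun hs => (hs ▸ hst).not_ge ht
  exact not_le.1 fun hle => h.notMem_of_lt hst ⟨hs0, hle⟩

end Localized

end CurriculumLearning

open CurriculumLearning in
theorem theorem4_general {d N T : ℕ} (hd : 2 ≤ d) (_ : 1 ≤ N) {σ2 : ModelIdx T → ℝ≥0}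
    {q : ModelIdx T → ℝ} (hq : q 0 = 0) (hσ : ∀ t, σ2 t ≤ σ2 0) {tw : ModelIdx T}
    (htw : IsWeakOracleModel σ2 q (weakOracleSet 1 N d σ2 q) tw) :
    ENNReal.ofReal (Real.exp (-1) ^ 2 / 2 * (d * σ2 tw / N)) ≤
        minimaxRisk N (fullyLocalized d q) σ2 ∧
      ((weakOracleSet 1 N d σ2 q).Nonempty →
        minimaxRisk N (fullyLocalized d q) σ2 ≤ minimaxRisk N (singleLocalized d T (q tw)) σ2) ∧
      ENNReal.ofReal (Real.exp (-1) ^ 2 / 8 * q tw ^ 2) ≤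
        minimaxRisk N (singleLocalized d T (q tw)) σ2 := by
  have hexp : Real.exp (-1) ^ 2 ≤ Real.exp (-1) / 2 := by
    have := Real.exp_neg_one_lt_half
    nlinarith [Real.exp_pos (-1)]
  refine ⟨?_, fun hne => minimaxRisk_mono (fullyLocalized_subset_singleLocalized
    (htw.mem hne).1), ?_⟩
  · obtain ⟨n, rfl⟩ : ∃ n, d = n + 1 := ⟨d - 1, by lia⟩
    have hn : ((n + 1 : ℕ) : ℝ) ≤ 2 * n := by exact_mod_cast (by lia : n + 1 ≤ 2 * n)
    refine le_trans ?_ (le_minimaxRisk_fullyLocalized hq (hσ tw) fun t ht => ?_)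
    · gcongr ENNReal.ofReal ?_
      calc _ ≤ Real.exp (-1) / 2 / 2 * (2 * n * σ2 tw / N) := by gcongr
        _ = Real.exp (-1) / 2 * (n * σ2 tw / N) := by ring
    · refine le_trans ?_ (htw.lt_sq_of_lt ht (hσ tw)).le
      rw [one_mul]
      gcongr
      exacts [Nat.le_succ n, hσ tw]
  · rcases htw.eq_zero_or_mem with rfl | hmem
    · simp [hq]
    · refine le_trans ?_ (le_minimaxRisk_singleLocalized (by lia) ?_ ?_)
      · gcongr ENNReal.ofReal (?_ * _)
        linarith [Real.exp_pos (-1)]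
      · exact (Fin.exists_succ_eq.2 hmem.1).elim fun s _ => s.pos
      · simpa using hmem.2

theorem theorem4 (d : ℕ) (hd : 3 ≤ d) :
    ∃ c : ℝ, Real.exp (-5) ≤ c ∧
      ∀ (N T : ℕ) (_ : 1 ≤ N) (σ2 : CurriculumLearning.ModelIdx T → NNReal)
        (q : CurriculumLearning.ModelIdx T → ℝ)
        (_ : q 0 = 0) (_ : Monotone fun t => q t ^ 2) (_ : Antitone σ2)
        (tw : CurriculumLearning.ModelIdx T)
        (_ : CurriculumLearning.IsWeakOracleModel σ2 q
          (CurriculumLearning.weakOracleSet 1 N d σ2 q) tw),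
        (q tw ^ 2 ≤ d * σ2 tw / N →
          ENNReal.ofReal (c ^ 2 / 2 * (d * σ2 tw / N)) ≤
              CurriculumLearning.minimaxRisk N (CurriculumLearning.fullyLocalized d q) σ2 ∧
            ((CurriculumLearning.weakOracleSet 1 N d σ2 q).Nonempty →
              CurriculumLearning.minimaxRisk N (CurriculumLearning.fullyLocalized d q) σ2 ≤
                CurriculumLearning.minimaxRisk N
                  (CurriculumLearning.singleLocalized d T (q tw)) σ2)) ∧
        (d * σ2 tw / N < q tw ^ 2 →
          ENNReal.ofReal (c ^ 2 / 8 * q tw ^ 2) ≤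
            CurriculumLearning.minimaxRisk N
              (CurriculumLearning.singleLocalized d T (q tw)) σ2) := by
  refine ⟨Real.exp (-1), Real.exp_le_exp.2 (by norm_num), fun N T hN σ2 q hq _ hσ tw htw => ?_⟩
  have ⟨hfull, hmono, hsingle⟩ :=
    theorem4_general (by lia) hN hq (fun t => hσ (Fin.zero_le t)) htw
  exact ⟨fun _ => ⟨hfull, hmono⟩, fun _ => hsingle⟩
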